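/- For $u\in L^2(\mathbb{R})$ let $$W(u,u)(x,v)=\int_{\mathbb{R}}u\left(x+\frac{y}{2}\right)\overline{u\left(x-\frac{y}{2}\right)}\,e^{-2\pi i vy}\,\mathrm{d}y,\qquad (x,v)\in\mathbb{R}\times\mathbb{R},$$ be its (real-valued) Wigner distribution. For each $0<\varepsilon\le 1$ there exists a constant $C_\varepsilon<\infty$, depending only on $\varepsilon$, such that for every $u_0\in L^2(\mathbb{R})$ and every convex subset $K$ of $\mathbb{R}^2$ of finite Lebesgue measure $|K|$, the function $W(u_0,u_0)$ is integrable on $K$ and $$\iint_K W(u_0,u_0)(x,v)\,\mathrm{d}x\,\mathrm{d}v\leq C_\varepsilon |K|^{\varepsilon}\|u_0\|_{L^2(\mathbb{R})}^2 .$$ -/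

import Mathlib

open MeasureTheory
open scoped ComplexConjugate

/-- The classical Wigner transform of `g₁, g₂ : ℝ → ℂ`,
`W(g₁, g₂)(x, v) = ∫ g₁(x + y/2) conj(g₂(x - y/2)) e^{-2πi v y} dy`.
For `g₁, g₂` in `L²(ℝ)` the integrand is integrable for all `x` and `v`. -/
noncomputable def wigner (g₁ g₂ : ℝ → ℂ) (x v : ℝ) : ℂ :=
  ∫ y : ℝ, g₁ (x + y / 2) * conj (g₂ (x - y / 2)) *
    Complex.exp (-2 * Real.pi * Complex.I * v * y)

/-- The Wigner distribution `W(u, u)` as a real-valued function on phase space; taking the real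
part loses nothing, see `ofReal_wignerDist`. -/
noncomputable def wignerDist (u : ℝ → ℂ) (x v : ℝ) : ℝ :=
  (wigner u u x v).re

theorem ofReal_wignerDist (u : ℝ → ℂ) (x v : ℝ) :
    ((wignerDist u x v : ℝ) : ℂ) = wigner u u x v := by
  unfold wignerDist
  rw [← Complex.conj_eq_iff_re]
  unfold wigner
  rw [← integral_conj, ← integral_neg_eq_self]
  congr 1
  funext y
  simp only [map_mul, Complex.conj_conj, ← Complex.exp_conj, map_neg, Complex.conj_ofReal,
    Complex.conj_I, map_ofNat]
  have h1 : x + -y / 2 = x - y / 2 := by ring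
  have h2 : x - -y / 2 = x + y / 2 := by ring
  rw [h1, h2]
  push_cast
  ring_nf

open scoped ENNReal

/-! Write `V` for the projection of `K` to the `x`-axis and `A = |V|`. Integrating over a vertical
slice first, only the phase depends on `v`; over an interval of length at most `L` it contributes at
most `min(L, 1/|y|) ≤ L^ε |y|^(ε-1)` (`norm_setIntegral_exp_le`). What remains is the integral over
`x ∈ V`, `y ∈ ℝ` of `|u(x+y/2)| |u(x-y/2)| |y|^(ε-1)`, which is `O(A^ε ‖u‖²)`
(`lintegral_reflection_weighted_le`). Convexity bounds every slice by `L = 4|K|/A`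
(`Convex.volume_slice_mul_volume_fst_le`), so `L^ε A^ε = (4|K|)^ε` and the shape of `K` drops out.
-/

/-! ### Integrals of reflected products -/

theorem map_add_half_volume (x : ℝ) :
    Measure.map (fun y : ℝ => x + y / 2) volume = (2 : ℝ≥0∞) • volume := by
  have h : (fun y : ℝ => x + y / 2) = (fun y => x + y) ∘ (fun y => (2 : ℝ)⁻¹ * y) := by
    ext y; simp; ring
  rw [h, ← Measure.map_map (by fun_prop) (by fun_prop), Real.map_volume_mul_left (by norm_num)]
  simp [Measure.map_smul, map_add_left_eq_self]

theorem map_sub_half_volume (x : ℝ) :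
    Measure.map (fun y : ℝ => x - y / 2) volume = (2 : ℝ≥0∞) • volume := by
  have h : (fun y : ℝ => x - y / 2) = (fun y => x + y) ∘ (fun y => (-2 : ℝ)⁻¹ * y) := by
    ext y; simp; ring
  rw [h, ← Measure.map_map (by fun_prop) (by fun_prop), Real.map_volume_mul_left (by norm_num)]
  simp [Measure.map_smul, map_add_left_eq_self]

theorem lintegral_comp_add_half {f : ℝ → ℝ≥0∞} (hf : Measurable f) (x : ℝ) :
    ∫⁻ y, f (x + y / 2) = 2 * ∫⁻ y, f y := by
  rw [← lintegral_map hf (g := fun y : ℝ => x + y / 2) (by fun_prop), map_add_half_volume,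
    lintegral_smul_measure, smul_eq_mul]

theorem lintegral_comp_sub_half {f : ℝ → ℝ≥0∞} (hf : Measurable f) (x : ℝ) :
    ∫⁻ y, f (x - y / 2) = 2 * ∫⁻ y, f y := by
  rw [← lintegral_map hf (g := fun y : ℝ => x - y / 2) (by fun_prop), map_sub_half_volume,
    lintegral_smul_measure, smul_eq_mul]

theorem ENNReal.mul_le_sq_add_sq (a b : ℝ≥0∞) : a * b ≤ a ^ 2 + b ^ 2 := by
  rcases le_total a b with h | h
  · calc a * b ≤ b ^ 2 := by rw [sq]; gcongr
      _ ≤ _ := le_add_self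
  · calc a * b ≤ a ^ 2 := by rw [sq]; gcongr
      _ ≤ _ := le_self_add

theorem lintegral_reflection_le {f : ℝ → ℝ≥0∞} (hf : Measurable f) (x : ℝ) :
    ∫⁻ y, f (x + y / 2) * f (x - y / 2) ≤ 4 * ∫⁻ y, f y ^ 2 := by
  calc ∫⁻ y, f (x + y / 2) * f (x - y / 2)
      ≤ ∫⁻ y, (f (x + y / 2) ^ 2 + f (x - y / 2) ^ 2) :=
        lintegral_mono fun y => ENNReal.mul_le_sq_add_sq _ _
    _ = 4 * ∫⁻ y, f y ^ 2 := by
        rw [lintegral_add_left (by fun_prop),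
          lintegral_comp_add_half (f := fun y => f y ^ 2) (by fun_prop),
          lintegral_comp_sub_half (f := fun y => f y ^ 2) (by fun_prop)]
        ring

theorem lintegral_midpoint_le {f : ℝ → ℝ≥0∞} (hf : Measurable f) (y : ℝ) :
    ∫⁻ x, f (x + y / 2) * f (x - y / 2) ≤ 2 * ∫⁻ y, f y ^ 2 := by
  calc ∫⁻ x, f (x + y / 2) * f (x - y / 2)
      ≤ ∫⁻ x, (f (x + y / 2) ^ 2 + f (x - y / 2) ^ 2) :=
        lintegral_mono fun y => ENNReal.mul_le_sq_add_sq _ _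
    _ = 2 * ∫⁻ y, f y ^ 2 := by
        rw [lintegral_add_left (by fun_prop),
          lintegral_add_right_eq_self (fun y => f y ^ 2) (y / 2),
          lintegral_sub_right_eq_self (fun y => f y ^ 2) (y / 2)]
        ring

theorem lintegral_Ioc_rpow_sub_one {ε A : ℝ} (hε : 0 < ε) (hA : 0 < A) :
    ∫⁻ y in Set.Ioc 0 A, ENNReal.ofReal (y ^ (ε - 1)) = ENNReal.ofReal (A ^ ε / ε) := by
  have hi : IntegrableOn (fun y : ℝ => y ^ (ε - 1)) (Set.Ioc 0 A) := by
    have := intervalIntegral.intervalIntegrable_rpow' (a := 0) (b := A) (r := ε - 1) (by linarith)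
    rwa [intervalIntegrable_iff_integrableOn_Ioc_of_le hA.le] at this
  rw [← ofReal_integral_eq_lintegral_ofReal hi, ← intervalIntegral.integral_of_le hA.le,
    integral_rpow (Or.inl (by linarith))]
  · simp [Real.zero_rpow hε.ne']
  · filter_upwards [ae_restrict_mem measurableSet_Ioc] with y hy
    exact Real.rpow_nonneg hy.1.le _

/-- Split at `|y| = A`. Near zero the weight is integrable, and integrating in `x` over all of `ℝ`
gives the `4/ε` term. Far out the weight is at most `A^(ε-1)`; integrating in `y` first and using
`|V| = A` gives the `4` term. -/
theorem lintegral_reflection_weighted_le {f : ℝ → ℝ≥0∞} (hf : Measurable f) {ε A : ℝ}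
    (hε : 0 < ε) (hε1 : ε ≤ 1) (hA : 0 < A) {V : Set ℝ} (hVA : volume V = ENNReal.ofReal A) :
    ∫⁻ x in V, ∫⁻ y, f (x + y / 2) * f (x - y / 2) * ENNReal.ofReal (|y| ^ (ε - 1)) ≤
      ENNReal.ofReal ((4 / ε + 4) * A ^ ε) * ∫⁻ y, f y ^ 2 := by
  set U := ∫⁻ y, f y ^ 2
  set h : ℝ → ℝ≥0∞ := (Set.Ioc 0 A).indicator fun y => ENNReal.ofReal (y ^ (ε - 1)) with hh
  have hhm : Measurable h := by
    refine Measurable.indicator ?_ measurableSet_Ioc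
    fun_prop
  have hhi : ∫⁻ y, h y = ENNReal.ofReal (A ^ ε / ε) := by
    rw [hh, lintegral_indicator measurableSet_Ioc, lintegral_Ioc_rpow_sub_one hε hA]
  have hw : ∀ y : ℝ, ENNReal.ofReal (|y| ^ (ε - 1)) ≤
      (h y + h (-y)) + ENNReal.ofReal (A ^ (ε - 1)) := by
    intro y
    rcases lt_or_ge A |y| with hy | hy
    · refine le_trans (ENNReal.ofReal_le_ofReal ?_) le_add_self
      exact Real.rpow_le_rpow_of_nonpos hA hy.le (by linarith)
    rcases lt_trichotomy y 0 with h0 | h0 | h0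
    · rw [abs_of_neg h0] at hy ⊢
      have : h (-y) = ENNReal.ofReal ((-y) ^ (ε - 1)) := by
        rw [hh, Set.indicator_of_mem]
        exact ⟨by linarith, hy⟩
      rw [← this]
      exact le_add_self.trans le_self_add
    · subst h0
      refine le_trans (ENNReal.ofReal_le_ofReal ?_) le_add_self
      -- At `y = 0` the weight is `0 ^ 0 = 1` if `ε = 1`, and the default value `0` otherwise.
      rcases eq_or_lt_of_le hε1 with rfl | hlt
      · simp
      · rw [abs_zero, Real.zero_rpow (by linarith)]
        positivity
    · rw [abs_of_pos h0] at hy ⊢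
      have : h y = ENNReal.ofReal (y ^ (ε - 1)) := by
        rw [hh, Set.indicator_of_mem]
        exact ⟨h0, hy⟩
      rw [← this]
      exact le_self_add.trans le_self_add
  have hnear : ∫⁻ x in V, ∫⁻ y, f (x + y / 2) * f (x - y / 2) * (h y + h (-y)) ≤
      ENNReal.ofReal (4 / ε * A ^ ε) * U := by
    rw [lintegral_lintegral_swap (by fun_prop)]
    calc ∫⁻ y, ∫⁻ x in V, f (x + y / 2) * f (x - y / 2) * (h y + h (-y))
        ≤ ∫⁻ y, (2 * U) * (h y + h (-y)) := by
          refine lintegral_mono fun y => ?_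
          rw [lintegral_mul_const _ (by fun_prop)]
          gcongr
          exact (setLIntegral_le_lintegral _ _).trans (lintegral_midpoint_le hf y)
      _ = (2 * U) * (2 * ENNReal.ofReal (A ^ ε / ε)) := by
          rw [lintegral_const_mul _ (by fun_prop), lintegral_add_left hhm,
            lintegral_neg_eq_self h, hhi, two_mul (ENNReal.ofReal _)]
      _ = _ := by
          have : 4 / ε * A ^ ε = 4 * (A ^ ε / ε) := by ring
          rw [this, ENNReal.ofReal_mul (by norm_num), ENNReal.ofReal_ofNat]
          ring
  have hfar : ∫⁻ x in V, ∫⁻ y, f (x + y / 2) * f (x - y / 2) * ENNReal.ofReal (A ^ (ε - 1)) ≤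
      ENNReal.ofReal (4 * A ^ ε) * U := by
    calc ∫⁻ x in V, ∫⁻ y, f (x + y / 2) * f (x - y / 2) * ENNReal.ofReal (A ^ (ε - 1))
        ≤ ∫⁻ _ in V, 4 * U * ENNReal.ofReal (A ^ (ε - 1)) := by
          refine lintegral_mono fun x => ?_
          rw [lintegral_mul_const _ (by fun_prop)]
          gcongr
          exact lintegral_reflection_le hf x
      _ = _ := by
          have : 4 * A ^ ε = 4 * (A ^ (ε - 1) * A) := by
            rw [← Real.rpow_add_one hA.ne']; ring_nf
          rw [setLIntegral_const, hVA, this, ENNReal.ofReal_mul (by norm_num),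
            ENNReal.ofReal_mul (by positivity), ENNReal.ofReal_ofNat]
          ring
  calc _ ≤ ∫⁻ x in V, ∫⁻ y, (f (x + y / 2) * f (x - y / 2) * (h y + h (-y)) +
        f (x + y / 2) * f (x - y / 2) * ENNReal.ofReal (A ^ (ε - 1))) := by
        refine lintegral_mono fun x => lintegral_mono fun y => ?_
        rw [← mul_add]
        gcongr
        exact hw y
    _ = (∫⁻ x in V, ∫⁻ y, f (x + y / 2) * f (x - y / 2) * (h y + h (-y))) +
        ∫⁻ x in V, ∫⁻ y, f (x + y / 2) * f (x - y / 2) * ENNReal.ofReal (A ^ (ε - 1)) := by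
        rw [← lintegral_add_left (by fun_prop)]
        refine lintegral_congr fun x => ?_
        rw [lintegral_add_left (by fun_prop)]
    _ ≤ ENNReal.ofReal (4 / ε * A ^ ε) * U + ENNReal.ofReal (4 * A ^ ε) * U :=
        add_le_add hnear hfar
    _ = _ := by
        rw [add_mul (4 / ε), ENNReal.ofReal_add (by positivity) (by positivity), add_mul]

/-! ### Slices of convex sets and the phase integral -/

/-- Averaging the slice at `x₀` with one point of `K` above `x` puts a half-size copy of it in the
slice at the midpoint. Integrating over `x` costs a second factor 2. -/
theorem Convex.volume_slice_mul_volume_fst_le {K : Set (ℝ × ℝ)} (hK : Convex ℝ K)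
    (hKm : MeasurableSet K) (x₀ : ℝ) :
    volume (Prod.mk x₀ ⁻¹' K) * volume (Prod.fst '' K) ≤ 4 * volume K := by
  set l : ℝ → ℝ≥0∞ := fun x => volume (Prod.mk x ⁻¹' K)
  have hl : Measurable l := measurable_measure_prodMk_left hKm
  have hmid : ∀ x ∈ Prod.fst '' K, l x₀ ≤ 2 * l (x₀ / 2 + x / 2) := by
    rintro _ ⟨⟨x, w⟩, hp, rfl⟩
    have hsub : Prod.mk x₀ ⁻¹' K ⊆
        (fun v : ℝ => w / 2 + v / 2) ⁻¹' (Prod.mk (x₀ / 2 + x / 2) ⁻¹' K) := by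
      intro v hv
      have := hK hv hp (a := 1 / 2) (b := 1 / 2) (by norm_num) (by norm_num) (by norm_num)
      have e : (1 / 2 : ℝ) • (x₀, v) + (1 / 2 : ℝ) • (x, w) = (x₀ / 2 + x / 2, w / 2 + v / 2) := by
        ext <;> simp <;> ring
      rwa [e] at this
    calc l x₀ ≤ volume ((fun v : ℝ => w / 2 + v / 2) ⁻¹' (Prod.mk (x₀ / 2 + x / 2) ⁻¹' K)) :=
          measure_mono hsub
      _ = 2 * l (x₀ / 2 + x / 2) := by
          rw [← Measure.map_apply (by fun_prop) (measurable_prodMk_left hKm), map_add_half_volume]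
          simp [l]
  calc l x₀ * volume (Prod.fst '' K) = ∫⁻ _ in Prod.fst '' K, l x₀ := by rw [setLIntegral_const]
    _ ≤ ∫⁻ x in Prod.fst '' K, 2 * l (x₀ / 2 + x / 2) :=
        setLIntegral_mono (by fun_prop) hmid
    _ ≤ ∫⁻ x, 2 * l (x₀ / 2 + x / 2) := setLIntegral_le_lintegral _ _
    _ = 4 * volume K := by
        rw [lintegral_const_mul _ (by fun_prop), lintegral_comp_add_half hl,
          Measure.volume_eq_prod, Measure.prod_apply hKm]
        ring

theorem Convex.exists_ae_eq_Ioc {S : Set ℝ} (hS : Convex ℝ S) (hfin : volume S ≠ ∞) :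
    ∃ a b : ℝ, a ≤ b ∧ S =ᵐ[volume] Set.Ioc a b := by
  rcases S.eq_empty_or_nonempty with rfl | ⟨z, hz⟩
  · exact ⟨0, 0, le_rfl, by simp⟩
  have hm := hS.isPreconnected.mem_intervals
  simp only [Set.mem_insert_iff, Set.mem_singleton_iff] at hm
  generalize sInf S = a at hm
  generalize sSup S = b at hm
  rcases hm with rfl | rfl | rfl | rfl | rfl | rfl | rfl | rfl | rfl | rfl
  · exact ⟨a, b, hz.1.trans hz.2, Ioc_ae_eq_Icc.symm⟩
  · exact ⟨a, b, hz.1.trans hz.2.le, Ico_ae_eq_Ioc⟩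
  · exact ⟨a, b, hz.1.le.trans hz.2, Filter.EventuallyEq.rfl⟩
  · exact ⟨a, b, hz.1.le.trans hz.2.le, Ioo_ae_eq_Ioc⟩
  -- Unbounded intervals have infinite measure; the empty set has no point `z`.
  all_goals simp at hfin hz

theorem norm_setIntegral_exp_le {S : Set ℝ} (hS : Convex ℝ S) {L ε : ℝ} (hL : 0 < L)
    (hε : 0 < ε) (hε1 : ε ≤ 1) (hSL : volume S ≤ ENNReal.ofReal L) {y : ℝ} (hy : y ≠ 0) :
    ‖∫ v in S, Complex.exp (-2 * Real.pi * Complex.I * v * y)‖ ≤ L ^ ε * |y| ^ (ε - 1) := by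
  obtain ⟨a, b, hab, hSab⟩ := hS.exists_ae_eq_Ioc (hSL.trans_lt ENNReal.ofReal_lt_top).ne
  have hba : b - a ≤ L := by
    rw [measure_congr hSab, Real.volume_Ioc] at hSL
    exact (ENNReal.ofReal_le_ofReal_iff hL.le).1 hSL
  have hnorm : ∀ v : ℝ, ‖Complex.exp (-2 * Real.pi * Complex.I * v * y)‖ = 1 := by
    intro v
    have : (-2 * Real.pi * Complex.I * v * y : ℂ) = ((-2 * Real.pi * v * y : ℝ) : ℂ) * Complex.I := by
      push_cast; ring
    rw [this, Complex.norm_exp_ofReal_mul_I]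
  rw [setIntegral_congr_set hSab, ← intervalIntegral.integral_of_le hab]
  set m := ‖∫ v in a..b, Complex.exp (-2 * Real.pi * Complex.I * v * y)‖ with hm
  have h1 : m ≤ L := by
    have := intervalIntegral.norm_integral_le_of_norm_le_const (a := a) (b := b) (C := 1)
      (f := fun v : ℝ => Complex.exp (-2 * Real.pi * Complex.I * v * y)) fun v _ => (hnorm v).le
    rw [abs_of_nonneg (by linarith)] at this
    linarith
  have h2 : m ≤ |y|⁻¹ := by
    set c : ℂ := -2 * Real.pi * Complex.I * y with hc
    have hc0 : c ≠ 0 := by simp [hc, hy, Real.pi_ne_zero]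
    have hcn : ‖c‖ = 2 * Real.pi * |y| := by
      simp [hc, abs_of_pos Real.pi_pos]
    have he : ∀ v : ℝ, Complex.exp (-2 * Real.pi * Complex.I * v * y) = Complex.exp (c * v) := by
      intro v; rw [hc]; ring_nf
    have hn : ∀ v : ℝ, ‖Complex.exp (c * v)‖ = 1 := fun v => by rw [← he, hnorm]
    have hy0 : 0 < |y| := abs_pos.2 hy
    rw [hm]
    simp_rw [he]
    rw [integral_exp_mul_complex hc0, norm_div, hcn, div_le_iff₀ (by positivity)]
    calc _ ≤ ‖Complex.exp (c * b)‖ + ‖Complex.exp (c * a)‖ := norm_sub_le _ _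
      _ = 2 := by rw [hn, hn]; norm_num
      _ ≤ 2 * Real.pi := by linarith [Real.pi_gt_three]
      _ = _ := by field_simp
  have hm0 : 0 ≤ m := norm_nonneg _
  -- Interpolate between the trivial bound `L` and the oscillatory bound `1/|y|`.
  calc m = m ^ ε * m ^ (1 - ε) := by
        rw [← Real.rpow_add_of_nonneg hm0 hε.le (by linarith)]; simp
    _ ≤ L ^ ε * (|y|⁻¹) ^ (1 - ε) := by
        gcongr
    _ = L ^ ε * |y| ^ (ε - 1) := by
        rw [Real.inv_rpow (abs_nonneg y), ← Real.rpow_neg (abs_nonneg y), neg_sub]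

/-! ### Estimates for the Wigner transform -/

theorem wigner_congr_ae {u w : ℝ → ℂ} (h : u =ᵐ[volume] w) (x v : ℝ) :
    wigner u u x v = wigner w w x v := by
  have h1 : ∀ᵐ y : ℝ, u (x + y / 2) = w (x + y / 2) := by
    refine ae_of_ae_map (f := fun y : ℝ => x + y / 2) (p := fun z => u z = w z) (by fun_prop) ?_
    rw [map_add_half_volume]
    exact Measure.ae_smul_measure h 2
  have h2 : ∀ᵐ y : ℝ, u (x - y / 2) = w (x - y / 2) := by
    refine ae_of_ae_map (f := fun y : ℝ => x - y / 2) (p := fun z => u z = w z) (by fun_prop) ?_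
    rw [map_sub_half_volume]
    exact Measure.ae_smul_measure h 2
  refine integral_congr_ae ?_
  filter_upwards [h1, h2] with y hy1 hy2
  rw [hy1, hy2]

theorem enorm_exp_wigner_phase (v y : ℝ) :
    ‖Complex.exp (-2 * Real.pi * Complex.I * v * y)‖ₑ = 1 := by
  have : (-2 * Real.pi * Complex.I * v * y : ℂ) = ((-2 * Real.pi * v * y : ℝ) : ℂ) * Complex.I := by
    push_cast; ring
  rw [← ofReal_norm, this, Complex.norm_exp_ofReal_mul_I, ENNReal.ofReal_one]

theorem enorm_wigner_le {u : ℝ → ℂ} (hu : Measurable u) (x v : ℝ) :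
    ‖wigner u u x v‖ₑ ≤ 4 * ∫⁻ y, ‖u y‖ₑ ^ 2 := by
  refine (enorm_integral_le_lintegral_enorm _).trans ?_
  simp only [enorm_mul, enorm_exp_wigner_phase, mul_one, RCLike.enorm_conj]
  exact lintegral_reflection_le (f := fun y => ‖u y‖ₑ) hu.enorm x

theorem measurable_wigner {u : ℝ → ℂ} (hu : Measurable u) :
    Measurable fun p : ℝ × ℝ => wigner u u p.1 p.2 := by
  refine (StronglyMeasurable.integral_prod_right (f := fun (p : ℝ × ℝ) (y : ℝ) =>
    u (p.1 + y / 2) * conj (u (p.1 - y / 2)) *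
      Complex.exp (-2 * Real.pi * Complex.I * p.2 * y)) ?_).measurable
  refine Measurable.stronglyMeasurable ?_
  have hc : Measurable fun z : ℂ => conj z := Complex.continuous_conj.measurable
  refine Measurable.mul (Measurable.mul ?_ (hc.comp ?_)) ?_ <;> fun_prop

theorem enorm_setIntegral_wigner_le {u : ℝ → ℂ} (hu : Measurable u)
    (hU : ∫⁻ y, ‖u y‖ₑ ^ 2 ≠ ∞) {S : Set ℝ} (hS : Convex ℝ S) {L ε : ℝ} (hL : 0 < L)
    (hε : 0 < ε) (hε1 : ε ≤ 1) (hSL : volume S ≤ ENNReal.ofReal L) (x : ℝ) :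
    ‖∫ v in S, wigner u u x v‖ₑ ≤ ENNReal.ofReal (L ^ ε) *
      ∫⁻ y, ‖u (x + y / 2)‖ₑ * ‖u (x - y / 2)‖ₑ * ENNReal.ofReal (|y| ^ (ε - 1)) := by
  have hc : Measurable fun z : ℂ => conj z := Complex.continuous_conj.measurable
  set G : ℝ → ℂ := fun y => u (x + y / 2) * conj (u (x - y / 2)) with hG
  have hGm : Measurable G := Measurable.mul (by fun_prop) (hc.comp (by fun_prop))
  have hGn : ∀ y, ‖G y‖ₑ = ‖u (x + y / 2)‖ₑ * ‖u (x - y / 2)‖ₑ := fun y => by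
    simp [hG, enorm_mul]
  have hGi : Integrable G := by
    refine ⟨hGm.aestronglyMeasurable, ?_⟩
    rw [hasFiniteIntegral_iff_enorm]
    simp_rw [hGn]
    exact (lintegral_reflection_le (f := fun y => ‖u y‖ₑ) hu.enorm x).trans_lt
      (ENNReal.mul_lt_top (by simp) hU.lt_top)
  have : IsFiniteMeasure (volume.restrict S) :=
    ⟨by rw [Measure.restrict_apply_univ]; exact hSL.trans_lt ENNReal.ofReal_lt_top⟩
  have hint : Integrable (Function.uncurry fun v y : ℝ =>
      G y * Complex.exp (-2 * Real.pi * Complex.I * v * y))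
      ((volume.restrict S).prod volume) := by
    refine (hGi.comp_snd (volume.restrict S)).mul_bdd (c := 1) ?_ ?_
    · exact Measurable.aestronglyMeasurable (by fun_prop)
    · refine Filter.Eventually.of_forall fun p => ?_
      rw [← toReal_enorm, enorm_exp_wigner_phase]; simp
  have hswap : ∫ v in S, wigner u u x v =
      ∫ y, G y * ∫ v in S, Complex.exp (-2 * Real.pi * Complex.I * v * y) := by
    unfold wigner
    rw [integral_integral_swap hint]
    exact integral_congr_ae (Filter.Eventually.of_forall fun y => integral_const_mul _ _)
  rw [hswap, ← lintegral_const_mul _ (by fun_prop)]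
  refine (enorm_integral_le_lintegral_enorm _).trans (lintegral_mono_ae ?_)
  -- For `ε < 1` the weight is `0` at `y = 0`, so the phase bound can fail there.
  filter_upwards [Measure.ae_ne volume (0 : ℝ)] with y hy
  rw [enorm_mul, hGn]
  calc _ ≤ ‖u (x + y / 2)‖ₑ * ‖u (x - y / 2)‖ₑ * ENNReal.ofReal (L ^ ε * |y| ^ (ε - 1)) := by
        gcongr
        rw [← ofReal_norm]
        exact ENNReal.ofReal_le_ofReal (norm_setIntegral_exp_le hS hL hε hε1 hSL hy)
    _ = _ := by
        rw [ENNReal.ofReal_mul (by positivity)]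
        ring

theorem integrableOn_wigner {u : ℝ → ℂ} (hu : Measurable u)
    (hU : ∫⁻ y, ‖u y‖ₑ ^ 2 ≠ ∞) {K : Set (ℝ × ℝ)} (hK : volume K ≠ ∞) :
    IntegrableOn (fun p : ℝ × ℝ => wigner u u p.1 p.2) K := by
  refine Measure.integrableOn_of_bounded (M := (4 * ∫⁻ y, ‖u y‖ₑ ^ 2).toReal) hK
    (measurable_wigner hu).aestronglyMeasurable (Filter.Eventually.of_forall fun p => ?_)
  rw [← toReal_enorm]
  exact ENNReal.toReal_mono (ENNReal.mul_ne_top (by simp) hU) (enorm_wigner_le hu _ _)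

theorem enorm_setIntegral_wigner_le_of_isOpen {u : ℝ → ℂ} (hu : Measurable u)
    (hU : ∫⁻ y, ‖u y‖ₑ ^ 2 ≠ ∞) {ε : ℝ} (hε : 0 < ε) (hε1 : ε ≤ 1) {K : Set (ℝ × ℝ)}
    (hK : Convex ℝ K) (hKo : IsOpen K) (hKfin : volume K ≠ ∞) :
    ‖∫ p in K, wigner u u p.1 p.2‖ₑ ≤
      ENNReal.ofReal ((4 / ε + 4) * 4 ^ ε * (volume K).toReal ^ ε) * ∫⁻ y, ‖u y‖ₑ ^ 2 := by
  rcases K.eq_empty_or_nonempty with rfl | hne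
  · simp
  have hKm := hKo.measurableSet
  set V := Prod.fst '' K with hV
  have hVo : IsOpen V := isOpenMap_fst K hKo
  have hVpos : 0 < volume V := hVo.measure_pos volume (hne.image _)
  have hKpos : 0 < (volume K).toReal := ENNReal.toReal_pos (hKo.measure_pos volume hne).ne' hKfin
  -- A nonempty slice of an open set has positive length, so the slice inequality with `|K| < ∞`
  -- forces `|V| < ∞`.
  have hVfin : volume V ≠ ∞ := by
    obtain ⟨⟨x, v⟩, hp⟩ := hne
    have hslice : 0 < volume (Prod.mk x ⁻¹' K) :=
      (hKo.preimage (by fun_prop)).measure_pos volume ⟨v, hp⟩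
    intro htop
    have := hK.volume_slice_mul_volume_fst_le hKm x
    rw [← hV, htop, ENNReal.mul_top hslice.ne', top_le_iff] at this
    exact ENNReal.mul_ne_top (by simp) hKfin this
  set A := (volume V).toReal with hA
  have hA0 : 0 < A := ENNReal.toReal_pos hVpos.ne' hVfin
  have hVA : volume V = ENNReal.ofReal A := (ENNReal.ofReal_toReal hVfin).symm
  set L := 4 * (volume K).toReal / A with hL
  have hL0 : 0 < L := by positivity
  have hslice : ∀ x, volume (Prod.mk x ⁻¹' K) ≤ ENNReal.ofReal L := by
    intro x
    have := hK.volume_slice_mul_volume_fst_le hKm x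
    rw [← hV, ← ENNReal.le_div_iff_mul_le (Or.inl hVpos.ne') (Or.inl hVfin)] at this
    rwa [hL, ENNReal.ofReal_div_of_pos hA0, ← hVA, ENNReal.ofReal_mul (by norm_num),
      ENNReal.ofReal_toReal hKfin, ENNReal.ofReal_ofNat]
  have hfub : ∫ p in K, wigner u u p.1 p.2 =
      ∫ x in V, ∫ v in Prod.mk x ⁻¹' K, wigner u u x v := by
    rw [← integral_indicator hKm, Measure.volume_eq_prod, integral_prod,
      ← integral_indicator hVo.measurableSet]
    · refine integral_congr_ae (Filter.Eventually.of_forall fun x => ?_)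
      dsimp only
      have hind : ∀ v, K.indicator (fun p : ℝ × ℝ => wigner u u p.1 p.2) (x, v) =
          (Prod.mk x ⁻¹' K).indicator (fun v => wigner u u x v) v := fun v => rfl
      simp_rw [hind]
      rw [integral_indicator (measurable_prodMk_left hKm)]
      by_cases hx : x ∈ V
      · rw [Set.indicator_of_mem hx]
      · have : Prod.mk x ⁻¹' K = ∅ := by
          ext v
          simp only [Set.mem_preimage, Set.mem_empty_iff_false, iff_false]
          exact fun h => hx ⟨_, h, rfl⟩
        rw [Set.indicator_of_notMem hx, this]
        simp
    · exact (integrableOn_wigner hu hU hKfin).integrable_indicator hKm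
  have hconv : ∀ x, Convex ℝ (Prod.mk x ⁻¹' K) := by
    intro x v hv w hw a b ha hb hab
    have := hK hv hw ha hb hab
    have e : a • (x, v) + b • (x, w) = (x, a • v + b • w) := by
      ext
      · simp [← add_mul, hab]
      · simp
    rwa [e] at this
  have hue : Measurable fun y => ‖u y‖ₑ := hu.enorm
  rw [hfub]
  calc _ ≤ ∫⁻ x in V, ‖∫ v in Prod.mk x ⁻¹' K, wigner u u x v‖ₑ :=
        enorm_integral_le_lintegral_enorm _
    _ ≤ ∫⁻ x in V, ENNReal.ofReal (L ^ ε) * ∫⁻ y, ‖u (x + y / 2)‖ₑ * ‖u (x - y / 2)‖ₑ *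
          ENNReal.ofReal (|y| ^ (ε - 1)) :=
        lintegral_mono fun x =>
          enorm_setIntegral_wigner_le hu hU (hconv x) hL0 hε hε1 (hslice x) x
    _ = ENNReal.ofReal (L ^ ε) * ∫⁻ x in V, ∫⁻ y, ‖u (x + y / 2)‖ₑ * ‖u (x - y / 2)‖ₑ *
          ENNReal.ofReal (|y| ^ (ε - 1)) := by
        rw [lintegral_const_mul _ (Measurable.lintegral_prod_right' (f := fun p : ℝ × ℝ =>
          ‖u (p.1 + p.2 / 2)‖ₑ * ‖u (p.1 - p.2 / 2)‖ₑ * ENNReal.ofReal (|p.2| ^ (ε - 1)))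
          (by fun_prop))]
    _ ≤ ENNReal.ofReal (L ^ ε) *
          (ENNReal.ofReal ((4 / ε + 4) * A ^ ε) * ∫⁻ y, ‖u y‖ₑ ^ 2) := by
        gcongr
        exact lintegral_reflection_weighted_le hue hε hε1 hA0 hVA
    _ = _ := by
        rw [← mul_assoc, ← ENNReal.ofReal_mul (by positivity)]
        congr 2
        have : (4 : ℝ) ^ ε * (volume K).toReal ^ ε = L ^ ε * A ^ ε := by
          rw [← Real.mul_rpow (by norm_num) hKpos.le, ← Real.mul_rpow hL0.le hA0.le, hL]
          congr 1
          field_simp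
        rw [mul_assoc (4 / ε + 4), this]
        ring

theorem toReal_lintegral_enorm_sq {u : ℝ → ℂ} :
    (∫⁻ y, ‖u y‖ₑ ^ 2).toReal = (eLpNorm u 2 volume).toReal ^ 2 := by
  rw [← ENNReal.toReal_pow, eLpNorm_eq_lintegral_rpow_enorm_toReal (by simp) (by simp),
    ← ENNReal.rpow_natCast, ← ENNReal.rpow_mul]
  norm_num

theorem theorem9p1 (ε : ℝ) (hε : 0 < ε) (hε1 : ε ≤ 1) :
    ∃ C : ℝ, ∀ u : ℝ → ℂ, MemLp u 2 volume →
      ∀ K : Set (ℝ × ℝ), Convex ℝ K → volume K ≠ ⊤ →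
        IntegrableOn (fun p : ℝ × ℝ => wignerDist u p.1 p.2) K volume ∧
          ∫ p in K, wignerDist u p.1 p.2 ≤
            C * (volume K).toReal ^ ε * (eLpNorm u 2 volume).toReal ^ 2 := by
  refine ⟨(4 / ε + 4) * 4 ^ ε, fun u₀ hu₀ K hK hKfin => ?_⟩
  obtain ⟨u, hu, huu⟩ := hu₀.1.aemeasurable
  have hdist : ∀ x v, wignerDist u₀ x v = wignerDist u x v := fun x v => by
    rw [wignerDist, wignerDist, wigner_congr_ae huu]
  simp_rw [hdist]
  rw [eLpNorm_congr_ae huu]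
  have hU : ∫⁻ y, ‖u y‖ₑ ^ 2 ≠ ∞ := by
    have h := ((memLp_congr_ae huu).1 hu₀).2
    rw [eLpNorm_lt_top_iff_lintegral_rpow_enorm_lt_top (by simp) (by simp)] at h
    simpa using h.ne
  refine ⟨(integrableOn_wigner hu hU hKfin).re, ?_⟩
  -- The frontier of a convex set is null, so `K` may be replaced by its interior; this also settles
  -- its measurability.
  have hint : interior K =ᵐ[volume] K :=
    interior_ae_eq_of_null_frontier (hK.addHaar_frontier volume)
  rw [← setIntegral_congr_set hint, ← measure_congr hint]
  rw [← measure_congr hint] at hKfin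
  have hmain := enorm_setIntegral_wigner_le_of_isOpen hu hU hε hε1 hK.interior isOpen_interior hKfin
  have hre : ((∫ p in interior K, wignerDist u p.1 p.2 : ℝ) : ℂ) =
      ∫ p in interior K, wigner u u p.1 p.2 := by
    rw [← integral_complex_ofReal]
    simp_rw [ofReal_wignerDist]
  rw [← hre] at hmain
  have hreal := ENNReal.toReal_mono (ENNReal.mul_ne_top ENNReal.ofReal_ne_top hU) hmain
  rw [toReal_enorm, ENNReal.toReal_mul, ENNReal.toReal_ofReal (by positivity),
    toReal_lintegral_enorm_sq, Complex.norm_real] at hreal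
  exact (le_abs_self _).trans hreal
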